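/- A rooted tree with $n$ nodes is a tree whose nodes are labelled bijectively by $1,\dots,n$, together with a distinguished node (any of the $n$ nodes), called the root. A node $v$ of a rooted tree is a record if its label is the largest among the labels of all nodes on the unique path from the root to $v$ (both ends included; in particular the root is a record). Let $R_\bullet(n,k)$ denote the number of rooted trees with $n$ nodes and exactly $k$ records. Then for every fixed integer $k\ge 0$, $$R_\bullet(n,k)\sim k\,n^{n-2}\qquad (n\to\infty),$$ that is, $R_\bullet(n,k)-k\,n^{n-2}=o(k\,n^{n-2})$. (For $k\ge 1$ this says that $R_\bullet(n,k)/(k\,n^{n-2})\to 1$; for $k=0$ it says that both sides vanish for all large $n$.) -/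

import Mathlib

open Filter Asymptotics

/-- A rooted labelled tree with `n` nodes: a tree on the label set `Fin n` (the labels
`1 < 2 < ⋯ < n`, shifted by one) together with a choice of a root, which may be any node. -/
structure RootedLabelledTree (n : ℕ) where
  graph : SimpleGraph (Fin n)
  isTree : graph.IsTree
  root : Fin n

namespace RootedLabelledTree

/-- The node `v` is a record if its label is the largest one among the labels of the nodes
on the (unique) path from the root to `v`, both ends included. -/
def IsRecord {n : ℕ} (T : RootedLabelledTree n) (v : Fin n) : Prop :=
  ∀ p : T.graph.Walk T.root v, p.IsPath → ∀ u ∈ p.support, u ≤ v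

/-- The number of records of a rooted tree. -/
noncomputable def numRecords {n : ℕ} (T : RootedLabelledTree n) : ℕ :=
  Set.ncard {v : Fin n | T.IsRecord v}

/-- There are only finitely many rooted trees on the label set `Fin n`, so that counting them
with `Set.ncard` is meaningful. -/
instance instFinite (n : ℕ) : Finite (RootedLabelledTree n) :=
  Finite.of_injective (fun T : RootedLabelledTree n => (T.graph, T.root)) (by
    rintro ⟨G, hG, r⟩ ⟨G', hG', r'⟩ h
    simp only [Prod.mk.injEq] at h
    obtain ⟨rfl, rfl⟩ := h
    rfl)

end RootedLabelledTree

/-- The tree record number: the number of rooted labelled trees with `n` nodes and exactly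
`k` records. -/
noncomputable def treeRecordNumber (n k : ℕ) : ℕ :=
  Set.ncard {T : RootedLabelledTree n | T.numRecords = k}

/-! Cut a tree at its largest label `M`. If `M` is the root, it is the only record. Otherwise remove
the subtree below `M`: a rooted tree on a set `S` remains. Its records are unchanged and `M` was the
only other one, as any node strictly below `M` is beaten by `M`. Conversely, a tree rooted at `M`
can be hung below any node of a tree on `S` (`glueEquiv`). Counting all trees this way gives
Cayley's formula (`treeCount_eq`); tracking records gives `recordCount_recursion`. Both recursions
are solved by Abel's binomial identity (`sum_choose_abelPoly_mul`). The outcome `recordCount_eq` is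
exact: for `n > k ≥ 1` it says R(n,k) = k · n(n-1)⋯(n-k+1) · n^(n-k-2), and the falling factorial is
asymptotic to n^k. -/

open Function

/-! ### Rooted trees as parent maps -/

/-- `f` sends every node of a tree rooted at `r` to its parent, and `r` to itself. -/
def IsParentMap {α : Type*} (r : α) (f : α → α) : Prop :=
  f r = r ∧ ∀ x, ∃ i, f^[i] x = r

/-- The records of the rooted tree with parent map `f`. -/
def parentMapRecords {α : Type*} [LE α] (f : α → α) : Set α :=
  {v | ∀ i, f^[i] v ≤ v}

namespace IsParentMap

variable {α : Type*} {r : α} {f : α → α}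

lemma iterate_root (hf : IsParentMap r f) (i : ℕ) : f^[i] r = r :=
  Function.iterate_fixed hf.1 i

/-- Going round the cycle `i` times takes at least `i` steps, by which time the root is reached and
never left. -/
lemma eq_root_of_iterate_eq (hf : IsParentMap r f) {x : α} {j : ℕ} (h : f^[j + 1] x = x) :
    x = r := by
  obtain ⟨i, hi⟩ := hf.2 x
  have h1 : f^[(j + 1) * i] x = x := by
    rw [Function.iterate_mul]
    exact Function.iterate_fixed h i
  have h2 : (j + 1) * i = j * i + i := by ring
  rw [h2, Function.iterate_add_apply, hi, hf.iterate_root] at h1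
  exact h1.symm

end IsParentMap

namespace SimpleGraph

variable {V : Type*} {G : SimpleGraph V}

/-- The unique path between two nodes of a tree. -/
noncomputable def IsTree.pathTo (hG : G.IsTree) (r v : V) : G.Walk v r :=
  (hG.existsUnique_path v r).choose

lemma IsTree.isPath_pathTo (hG : G.IsTree) (r v : V) : (hG.pathTo r v).IsPath :=
  (hG.existsUnique_path v r).choose_spec.1

lemma IsTree.eq_pathTo (hG : G.IsTree) {r v : V} {p : G.Walk v r} (hp : p.IsPath) :
    p = hG.pathTo r v :=
  (hG.existsUnique_path v r).choose_spec.2 p hp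

/-- The parent of a node in a tree rooted at `r`; the root is its own parent. -/
noncomputable def IsTree.parent (hG : G.IsTree) (r v : V) : V :=
  (hG.pathTo r v).snd

lemma IsTree.parent_iterate (hG : G.IsTree) (r : V) (i : ℕ) (v : V) :
    (hG.parent r)^[i] v = (hG.pathTo r v).getVert i := by
  induction i generalizing v with
  | zero => simp
  | succ i ih =>
    have h : (hG.pathTo r v).tail = hG.pathTo r (hG.parent r v) :=
      hG.eq_pathTo (hG.isPath_pathTo r v).tail
    rw [Function.iterate_succ_apply, ih, ← h]
    exact Walk.getVert_tail _

lemma IsTree.pathTo_self (hG : G.IsTree) (r : V) : hG.pathTo r r = Walk.nil :=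
  (hG.eq_pathTo Walk.IsPath.nil).symm

lemma IsTree.isParentMap_parent (hG : G.IsTree) (r : V) : IsParentMap r (hG.parent r) := by
  refine ⟨by simp [IsTree.parent, hG.pathTo_self], fun x => ⟨(hG.pathTo r x).length, ?_⟩⟩
  rw [hG.parent_iterate, Walk.getVert_length]

lemma IsTree.adj_parent (hG : G.IsTree) {r v : V} (hv : v ≠ r) : G.Adj v (hG.parent r v) :=
  Walk.adj_snd (Walk.not_nil_of_ne hv)

/-- This makes the parent map determine the tree. If `v` is on the path from `u` to `r`, acyclicity
makes it the second node; if not, prepending `v` gives the path from `v`. -/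
lemma IsTree.adj_iff_parent (hG : G.IsTree) (r u v : V) :
    G.Adj u v ↔ u ≠ v ∧ (hG.parent r u = v ∨ hG.parent r v = u) := by
  constructor
  · intro h
    refine ⟨h.ne, ?_⟩
    by_cases hv : v ∈ (hG.pathTo r u).support
    · exact Or.inl (hG.isAcyclic.eq_snd_of_adj_start (hG.isPath_pathTo r u) h hv).symm
    · right
      have := hG.eq_pathTo ((hG.isPath_pathTo r u).cons hv (h := h.symm))
      rw [IsTree.parent, ← this, Walk.snd_cons]
  · rintro ⟨hne, h | h⟩
    · have hu : u ≠ r := fun hu => hne (by rw [← h, hu, (hG.isParentMap_parent r).1])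
      exact h ▸ hG.adj_parent hu
    · have hv : v ≠ r := fun hv => hne (by rw [← h, hv, (hG.isParentMap_parent r).1])
      exact (h ▸ hG.adj_parent hv).symm

end SimpleGraph

namespace IsParentMap

variable {α : Type*} {r : α} {f : α → α}

/-- Every node reaches `r`, and each edge is `s(x, f x)` with `x ≠ r`, so the graph is connected
with too few edges for a cycle. -/
lemma isTree_fromRel [Finite α] (hf : IsParentMap r f) :
    (SimpleGraph.fromRel fun u v => f u = v).IsTree := by
  classical
  set G := SimpleGraph.fromRel fun u v => f u = v
  have hstep (x : α) : G.Reachable x (f x) := by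
    by_cases hx : x = f x
    · rw [← hx]
    · exact SimpleGraph.Adj.reachable ((SimpleGraph.fromRel_adj _ _ _).2 ⟨hx, Or.inl rfl⟩)
  have hiter (i : ℕ) (x : α) : G.Reachable x (f^[i] x) := by
    induction i with
    | zero => rfl
    | succ i ih =>
      rw [Function.iterate_succ_apply']
      exact ih.trans (hstep _)
  have hroot (x : α) : G.Reachable x r := by
    obtain ⟨i, hi⟩ := hf.2 x
    exact hi ▸ hiter i x
  have hconn : G.Connected :=
    { preconnected := fun x y => (hroot x).trans (hroot y).symm, nonempty := ⟨r⟩ }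
  refine SimpleGraph.isTree_iff_connected_and_card.2
    ⟨hconn, le_antisymm ?_ hconn.card_vert_le_card_edgeSet_add_one⟩
  have hsub : G.edgeSet ⊆ (fun x => s(x, f x)) '' {r}ᶜ := by
    intro e
    induction e using Sym2.ind with
    | _ u v =>
      rw [SimpleGraph.mem_edgeSet, SimpleGraph.fromRel_adj]
      rintro ⟨hne, h | h⟩
      · exact ⟨u, fun hu => hne (by rw [← h, hu, hf.1]), by rw [← h]⟩
      · exact ⟨v, fun hv => hne (by rw [← h, hv, hf.1]), by rw [← h, Sym2.eq_swap]⟩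
  have h1 := (Set.ncard_le_ncard hsub (Set.toFinite _)).trans
    (Set.ncard_image_le (Set.toFinite _))
  have h2 := Set.ncard_add_ncard_compl ({r} : Set α)
  rw [Set.ncard_singleton] at h2
  rw [Nat.card_coe_set_eq]
  omega

lemma parent_fromRel [Finite α] (hf : IsParentMap r f) : hf.isTree_fromRel.parent r = f := by
  funext x
  -- Induction on the distance to the root: were `x` the parent of `f x`, then `f (f x) = x` would
  -- be a 2-cycle.
  have key (i : ℕ) : ∀ x, f^[i] x = r → hf.isTree_fromRel.parent r x = f x := by
    induction i with
    | zero =>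
      rintro x rfl
      exact (hf.isTree_fromRel.isParentMap_parent _).1.trans hf.1.symm
    | succ i ih =>
      intro x hx
      rw [Function.iterate_succ_apply] at hx
      by_cases hxr : x = r
      · rw [hxr, hf.1]
        exact (hf.isTree_fromRel.isParentMap_parent _).1
      have hne : x ≠ f x := fun h => hxr (hf.eq_root_of_iterate_eq (j := 0) h.symm)
      have hadj : (SimpleGraph.fromRel fun u v => f u = v).Adj x (f x) :=
        (SimpleGraph.fromRel_adj _ _ _).2 ⟨hne, Or.inl rfl⟩
      rcases ((hf.isTree_fromRel.adj_iff_parent r _ _).1 hadj).2 with h | h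
      · exact h
      · rw [ih _ hx] at h
        exact absurd (hf.eq_root_of_iterate_eq (j := 1) h) hxr
  obtain ⟨i, hi⟩ := hf.2 x
  exact key i x hi

end IsParentMap

/-- The parent maps on `α`, together with their roots. -/
abbrev RootedMap (α : Type*) : Type _ := {p : (α → α) × α // IsParentMap p.2 p.1}

namespace RootedLabelledTree

variable {n : ℕ}

/-- The parent map of a rooted labelled tree. -/
noncomputable def toRootedMap (T : RootedLabelledTree n) : RootedMap (Fin n) :=
  ⟨(T.isTree.parent T.root, T.root), T.isTree.isParentMap_parent T.root⟩

lemma toRootedMap_bijective : Function.Bijective (toRootedMap (n := n)) := by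
  constructor
  · rintro ⟨G, hG, r⟩ ⟨G', hG', r'⟩ h
    simp only [toRootedMap, Subtype.mk.injEq, Prod.mk.injEq] at h
    obtain ⟨h, rfl⟩ := h
    have : G = G' := by
      ext u v
      rw [hG.adj_iff_parent r, hG'.adj_iff_parent r, h]
    subst this
    rfl
  · rintro ⟨⟨f, r⟩, hf⟩
    exact ⟨⟨_, IsParentMap.isTree_fromRel hf, r⟩,
      Subtype.ext (Prod.ext (IsParentMap.parent_fromRel hf) rfl)⟩

lemma isRecord_iff (T : RootedLabelledTree n) (v : Fin n) :
    T.IsRecord v ↔ v ∈ parentMapRecords T.toRootedMap.1.1 := by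
  have hsupp (u : Fin n) : u ∈ (T.isTree.pathTo T.root v).support ↔
      ∃ i, (T.isTree.parent T.root)^[i] v = u := by
    simp only [T.isTree.parent_iterate]
    rw [SimpleGraph.Walk.mem_support_iff_exists_getVert]
    refine ⟨fun ⟨i, hi, _⟩ => ⟨i, hi⟩, fun ⟨i, hi⟩ => ?_⟩
    -- Beyond the length, `getVert` stays at the endpoint, just as the parent map fixes the root.
    rcases le_total i (T.isTree.pathTo T.root v).length with hle | hle
    · exact ⟨i, hi, hle⟩
    · exact ⟨_, by rw [← hi, SimpleGraph.Walk.getVert_of_length_le _ hle,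
        SimpleGraph.Walk.getVert_length], le_rfl⟩
  constructor
  · intro h i
    refine h (T.isTree.pathTo T.root v).reverse (T.isTree.isPath_pathTo _ _).reverse _ ?_
    rw [SimpleGraph.Walk.support_reverse, List.mem_reverse, hsupp]
    exact ⟨i, rfl⟩
  · intro h p hp u hu
    have hu' : u ∈ p.reverse.support := by
      rwa [SimpleGraph.Walk.support_reverse, List.mem_reverse]
    rw [T.isTree.eq_pathTo hp.reverse, hsupp] at hu'
    obtain ⟨i, rfl⟩ := hu'
    exact h i

lemma numRecords_eq (T : RootedLabelledTree n) :
    T.numRecords = (parentMapRecords T.toRootedMap.1.1).ncard := by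
  rw [numRecords]
  congr 1
  ext v
  exact T.isRecord_iff v

end RootedLabelledTree

/-- The number of rooted trees on `α` with `k` records. -/
noncomputable def recordCount (α : Type*) [LE α] (k : ℕ) : ℕ :=
  Nat.card {p : RootedMap α // (parentMapRecords p.1.1).ncard = k}

lemma treeRecordNumber_eq_recordCount (n k : ℕ) :
    treeRecordNumber n k = recordCount (Fin n) k := by
  rw [treeRecordNumber, ← Nat.card_coe_set_eq]
  refine Nat.card_congr ((Equiv.ofBijective _
    RootedLabelledTree.toRootedMap_bijective).subtypeEquiv fun T => ?_)
  rw [Set.mem_ofPred_eq, T.numRecords_eq]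
  rfl

/-- The number of parent maps on `α` with root `r`. -/
noncomputable def rootedAtCount {α : Type*} (r : α) : ℕ :=
  Nat.card {f : α → α // IsParentMap r f}

/-! ### Invariance under relabelling -/

section Transport

variable {α β : Type*}

lemma IsParentMap.conj {r : α} {f : α → α} (hf : IsParentMap r f) (e : α ≃ β) :
    IsParentMap (e r) (e.conj f) := by
  have hit (i : ℕ) (x : β) : (e.conj f)^[i] x = e (f^[i] (e.symm x)) := by
    have h : Semiconj e f (e.conj f) := fun x => by simp [Equiv.conj_apply]
    rw [(h.iterate_right i).eq, e.apply_symm_apply]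
  refine ⟨by simp [Equiv.conj_apply, hf.1], fun x => ?_⟩
  obtain ⟨i, hi⟩ := hf.2 (e.symm x)
  exact ⟨i, by rw [hit, hi]⟩

lemma isParentMap_conj_iff {r : α} {f : α → α} (e : α ≃ β) :
    IsParentMap (e r) (e.conj f) ↔ IsParentMap r f := by
  refine ⟨fun h => ?_, fun h => h.conj e⟩
  have := h.conj e.symm
  rwa [e.symm_apply_apply, show e.symm.conj (e.conj f) = f by ext; simp [Equiv.conj_apply]] at this

lemma rootedAtCount_congr (e : α ≃ β) (r : α) : rootedAtCount (e r) = rootedAtCount r :=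
  (Nat.card_congr (e.conj.subtypeEquiv fun _ => (isParentMap_conj_iff e).symm)).symm

lemma rootedAtCount_eq_of_card_eq [Finite α] [Finite β] (h : Nat.card α = Nat.card β)
    (r : α) (s : β) : rootedAtCount r = rootedAtCount s := by
  classical
  have e : α ≃ β := (Finite.card_eq.1 h).some
  rw [← rootedAtCount_congr (e.trans (Equiv.swap (e r) s)) r]
  simp

/-- Rooted trees are carried along by a bijection of their node sets. -/
def RootedMap.congr (e : α ≃ β) : RootedMap α ≃ RootedMap β :=
  (e.conj.prodCongr e).subtypeEquiv fun _ => (isParentMap_conj_iff e).symm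

lemma ncard_parentMapRecords_conj [LE α] [LE β] (e : α ≃o β) (f : α → α) :
    (parentMapRecords (e.toEquiv.conj f)).ncard = (parentMapRecords f).ncard := by
  have hit (i : ℕ) (x : α) : (e.toEquiv.conj f)^[i] (e x) = e (f^[i] x) := by
    have h : Semiconj e f (e.toEquiv.conj f) := fun x => by simp [Equiv.conj_apply]
    exact ((h.iterate_right i).eq x).symm
  have : parentMapRecords (e.toEquiv.conj f) = e '' parentMapRecords f := by
    ext v
    obtain ⟨v, rfl⟩ := e.surjective v
    rw [e.injective.mem_set_image]
    exact forall_congr' fun i => by rw [hit, e.le_iff_le]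
  rw [this, Set.ncard_image_of_injective _ e.injective]

lemma recordCount_congr [LE α] [LE β] (e : α ≃o β) (k : ℕ) :
    recordCount α k = recordCount β k :=
  Nat.card_congr ((RootedMap.congr e.toEquiv).subtypeEquiv fun p => by
    rw [← ncard_parentMapRecords_conj e p.1.1]
    rfl)

lemma card_rootedMap [Finite α] (r : α) :
    Nat.card (RootedMap α) = Nat.card α * rootedAtCount r := by
  have e : RootedMap α ≃ Σ s : α, {f : α → α // IsParentMap s f} :=
    { toFun := fun p => ⟨p.1.2, p.1.1, p.2⟩
      invFun := fun q => ⟨(q.2.1, q.1), q.2.2⟩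
      left_inv := fun _ => rfl
      right_inv := fun _ => rfl }
  have := Fintype.ofFinite α
  rw [Nat.card_congr e, Nat.card_sigma]
  change ∑ s : α, rootedAtCount s = _
  rw [Finset.sum_congr rfl fun s _ => rootedAtCount_eq_of_card_eq rfl s r]
  simp

end Transport

/-! ### Cutting and gluing at the largest label -/

section Glue

variable {α : Type*} {M : α} {S : Set α}

open Classical in
/-- Hang a tree on `Sᶜ` with root `M` below the node `u` of a tree on `S`. -/
noncomputable def glueMap (M : α) (g : S → S) (u : S) (h : ↥Sᶜ → ↥Sᶜ) (x : α) : α :=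
  if hx : x ∈ S then g ⟨x, hx⟩ else if x = M then u else h ⟨x, hx⟩

variable {g : S → S} {u : S} {h : ↥Sᶜ → ↥Sᶜ}

lemma glueMap_coe (x : S) : glueMap M g u h x = g x := by
  simp [glueMap]

lemma glueMap_self (hM : M ∉ S) : glueMap M g u h M = u := by
  simp [glueMap, hM]

lemma glueMap_coe_compl {x : ↥Sᶜ} (hx : (x : α) ≠ M) : glueMap M g u h x = h x := by
  have : (x : α) ∉ S := x.2
  simp [glueMap, this, hx]

lemma glueMap_iterate_coe (i : ℕ) (x : S) : (glueMap M g u h)^[i] x = g^[i] x := by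
  have : Semiconj ((↑) : S → α) g (glueMap M g u h) := fun x => (glueMap_coe x).symm
  exact ((this.iterate_right i).eq x).symm

lemma exists_glueMap_iterate_eq (hM : M ∉ S) (hh : IsParentMap ⟨M, hM⟩ h) (x : ↥Sᶜ) :
    ∃ i, (glueMap M g u h)^[i] x = M := by
  obtain ⟨i, hi⟩ := hh.2 x
  induction i generalizing x with
  | zero => exact ⟨0, congrArg Subtype.val hi⟩
  | succ i ih =>
    by_cases hx : (x : α) = M
    · exact ⟨0, hx⟩
    · obtain ⟨j, hj⟩ := ih (h x) hi
      exact ⟨j + 1, by rw [iterate_succ_apply, glueMap_coe_compl hx, hj]⟩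

/-- The nodes of the subtree rooted at `M`. -/
def descendants (f : α → α) (M : α) : Set α :=
  {x | ∃ i, f^[i] x = M}

lemma descendants_glueMap (hM : M ∉ S) (hh : IsParentMap ⟨M, hM⟩ h) :
    descendants (glueMap M g u h) M = Sᶜ := by
  ext x
  constructor
  · rintro ⟨i, hi⟩ hx
    rw [glueMap_iterate_coe i ⟨x, hx⟩] at hi
    exact hM (hi ▸ Subtype.coe_prop _)
  · intro hx
    exact exists_glueMap_iterate_eq hM hh ⟨x, hx⟩

lemma isParentMap_glueMap {r : S} (hM : M ∉ S) (hg : IsParentMap r g)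
    (hh : IsParentMap ⟨M, hM⟩ h) : IsParentMap (r : α) (glueMap M g u h) := by
  have hS (x : S) : ∃ i, (glueMap M g u h)^[i] x = r := by
    obtain ⟨i, hi⟩ := hg.2 x
    exact ⟨i, by rw [glueMap_iterate_coe, hi]⟩
  refine ⟨by rw [glueMap_coe, hg.1], fun x => ?_⟩
  by_cases hx : x ∈ S
  · exact hS ⟨x, hx⟩
  · obtain ⟨i, hi⟩ := exists_glueMap_iterate_eq (g := g) (u := u) hM hh ⟨x, hx⟩
    obtain ⟨j, hj⟩ := hS u
    exact ⟨j + (1 + i), by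
      rw [iterate_add_apply, iterate_add_apply, hi, iterate_one, glueMap_self hM, hj]⟩

/-- Parent chains starting in `S` stay in `S`; those starting outside pass through `M`, which
exceeds every other label. -/
lemma parentMapRecords_glueMap [PartialOrder α] (hmax : ∀ x, x ≤ M) (hM : M ∉ S)
    (hh : IsParentMap ⟨M, hM⟩ h) :
    parentMapRecords (glueMap M g u h) = insert M ((↑) '' parentMapRecords g) := by
  ext x
  by_cases hx : x ∈ S
  · have hxM : x ≠ M := fun e => hM (e ▸ hx)
    rw [Set.mem_insert_iff, or_iff_right hxM]
    lift x to S using hx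
    rw [Subtype.val_injective.mem_set_image]
    exact forall_congr' fun i => by rw [glueMap_iterate_coe, Subtype.coe_le_coe]
  · have hx' : x ∉ ((↑) : S → α) '' parentMapRecords g := by
      rintro ⟨y, -, rfl⟩
      exact hx y.2
    rw [Set.mem_insert_iff, or_iff_left hx']
    constructor
    · intro hrec
      obtain ⟨i, hi⟩ := exists_glueMap_iterate_eq (g := g) (u := u) hM hh ⟨x, hx⟩
      exact le_antisymm (hmax x) (hi ▸ hrec i)
    · rintro rfl i
      exact hmax _

lemma ncard_parentMapRecords_glueMap [Finite α] [PartialOrder α] (hmax : ∀ x, x ≤ M)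
    (hM : M ∉ S) (hh : IsParentMap ⟨M, hM⟩ h) :
    (parentMapRecords (glueMap M g u h)).ncard = (parentMapRecords g).ncard + 1 := by
  rw [parentMapRecords_glueMap hmax hM hh, Set.ncard_insert_of_notMem,
    Set.ncard_image_of_injective _ Subtype.val_injective]
  rintro ⟨y, -, rfl⟩
  exact hM y.2

/-- The non-descendants of `M` are closed under `f`. The parent of `M` is among them, since
otherwise `M` would lie on a cycle and be the root. -/
lemma exists_eq_glueMap {f : α → α} {r : α} (hf : IsParentMap r f) (hr : r ≠ M)
    (hM : M ∉ S) (hd : descendants f M = Sᶜ) :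
    ∃ (g : S → S) (s u : S) (h : ↥Sᶜ → ↥Sᶜ), IsParentMap s g ∧ IsParentMap ⟨M, hM⟩ h ∧
      (s : α) = r ∧ glueMap M g u h = f := by
  classical
  have hmem (x : α) : x ∉ S ↔ ∃ i, f^[i] x = M := by
    rw [← Set.mem_compl_iff, ← hd]
    rfl
  have hS {x : α} (hx : x ∈ S) : f x ∈ S := by
    by_contra hfx
    obtain ⟨i, hi⟩ := (hmem _).1 hfx
    exact (hmem x).2 ⟨i + 1, hi⟩ hx
  have hSc {x : α} (hx : x ∉ S) (hxM : x ≠ M) : f x ∉ S := by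
    obtain ⟨i, hi⟩ := (hmem _).1 hx
    cases i with
    | zero => exact absurd hi hxM
    | succ i => exact (hmem _).2 ⟨i, hi⟩
  have hfM : f M ∈ S := by
    by_contra hfM
    obtain ⟨i, hi⟩ := (hmem _).1 hfM
    exact hr (hf.eq_root_of_iterate_eq (j := i) hi).symm
  have hrS : r ∈ S := by
    by_contra hrS
    obtain ⟨i, hi⟩ := (hmem _).1 hrS
    exact hr (by rw [← hi, hf.iterate_root])
  let g : S → S := fun x => ⟨f x, hS x.2⟩
  let h : ↥Sᶜ → ↥Sᶜ := fun x => if hx : (x : α) = M then ⟨M, hM⟩ else ⟨f x, hSc x.2 hx⟩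
  have hg : IsParentMap ⟨r, hrS⟩ g := by
    refine ⟨Subtype.ext hf.1, fun x => ?_⟩
    obtain ⟨i, hi⟩ := hf.2 x
    have : Semiconj ((↑) : S → α) g f := fun _ => rfl
    exact ⟨i, Subtype.ext (((this.iterate_right i).eq x).trans hi)⟩
  have hhM : h ⟨M, hM⟩ = ⟨M, hM⟩ := by simp [h]
  have hh : IsParentMap ⟨M, hM⟩ h := by
    refine ⟨hhM, fun x => ?_⟩
    obtain ⟨i, hi⟩ := (hmem x).1 x.2
    induction i generalizing x with
    | zero => exact ⟨0, Subtype.ext hi⟩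
    | succ i ih =>
      by_cases hx : (x : α) = M
      · exact ⟨0, Subtype.ext hx⟩
      · have hhx : h x = ⟨f x, hSc x.2 hx⟩ := by simp [h, hx]
        obtain ⟨j, hj⟩ := ih (h x) (by rw [hhx]; exact hi)
        exact ⟨j + 1, hj⟩
  refine ⟨g, ⟨r, hrS⟩, ⟨f M, hfM⟩, h, hg, hh, rfl, ?_⟩
  funext x
  by_cases hx : x ∈ S
  · simp [glueMap, hx, g]
  · by_cases hxM : x = M
    · subst hxM
      simp [glueMap, hx]
    · simp [glueMap, hx, hxM, h]

lemma glueMap_injective (hM : M ∉ S) {g' : S → S} {u' : S} {h' : ↥Sᶜ → ↥Sᶜ}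
    (hh : IsParentMap ⟨M, hM⟩ h) (hh' : IsParentMap ⟨M, hM⟩ h')
    (heq : glueMap M g u h = glueMap M g' u' h') : g = g' ∧ u = u' ∧ h = h' := by
  refine ⟨?_, ?_, ?_⟩
  · funext x
    apply Subtype.ext
    rw [← glueMap_coe (M := M) (u := u) (h := h), heq, glueMap_coe]
  · apply Subtype.ext
    rw [← glueMap_self (g := g) (h := h) hM, heq, glueMap_self hM]
  · funext x
    by_cases hx : (x : α) = M
    · have : x = ⟨M, hM⟩ := Subtype.ext hx
      rw [this, hh.1, hh'.1]
    · apply Subtype.ext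
      rw [← glueMap_coe_compl (g := g) (u := u) hx, heq, glueMap_coe_compl hx]

/-- The triples that `glueMap` combines: a rooted tree on `S`, a node of it, and a tree on `Sᶜ`
with root `M`. -/
abbrev GlueData (hM : M ∉ S) : Type _ :=
  RootedMap S × S × {h : ↥Sᶜ → ↥Sᶜ // IsParentMap ⟨M, hM⟩ h}

/-- The rooted trees on `α` whose root is not `M`, and in which `Sᶜ` is the subtree below `M`,
correspond to the ways to hang a tree on `Sᶜ` with root `M` below a node of a tree on `S`. -/
noncomputable def glueEquiv (hM : M ∉ S) :
    GlueData hM ≃ {p : RootedMap α // p.1.2 ≠ M ∧ descendants p.1.1 M = Sᶜ} :=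
  Equiv.ofBijective
    (fun q => ⟨⟨(glueMap M q.1.1.1 q.2.1 q.2.2.1, q.1.1.2),
      isParentMap_glueMap hM q.1.2 q.2.2.2⟩,
      fun e => hM (e ▸ q.1.1.2.2), descendants_glueMap hM q.2.2.2⟩) (by
    constructor
    · rintro ⟨⟨⟨g, s⟩, hg⟩, u, ⟨h, hh⟩⟩ ⟨⟨⟨g', s'⟩, hg'⟩, u', ⟨h', hh'⟩⟩ heq
      simp only [Subtype.mk.injEq, Prod.mk.injEq] at heq
      obtain ⟨rfl, rfl, rfl⟩ := glueMap_injective hM hh hh' heq.1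
      obtain rfl : s = s' := Subtype.ext heq.2
      rfl
    · rintro ⟨⟨⟨f, r⟩, hf⟩, hr, hd⟩
      obtain ⟨g, s, u, h, hg, hh, rfl, rfl⟩ := exists_eq_glueMap hf hr hM hd
      exact ⟨⟨⟨⟨g, s⟩, hg⟩, u, ⟨h, hh⟩⟩, rfl⟩)

end Glue

/-! ### Recursions over the set of nodes not below the largest label -/

lemma card_root_eq {α : Type*} (M : α) {P : RootedMap α → Prop}
    (hP : ∀ f (hf : IsParentMap M f), P ⟨(f, M), hf⟩) :
    Nat.card {p : RootedMap α // p.1.2 = M ∧ P p} = rootedAtCount M := by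
  refine Nat.card_congr
    { toFun := fun p => ⟨p.1.1.1, by have h := p.1.2; rwa [p.2.1] at h⟩
      invFun := fun f => ⟨⟨(f.1, M), f.2⟩, rfl, hP f.1 f.2⟩
      left_inv := ?_
      right_inv := fun _ => rfl }
  rintro ⟨⟨⟨f, r⟩, hf⟩, hr, -⟩
  obtain rfl : r = M := hr
  rfl

section Recursion

variable {α : Type*} [Finite α]

lemma card_eq_sum_descendants (M : α) (P : RootedMap α → Prop) :
    Nat.card {p : RootedMap α // P p} =
      Nat.card {p : RootedMap α // p.1.2 = M ∧ P p} +
      ∑ᶠ S : {S : Set α // M ∉ S},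
        Nat.card {p : RootedMap α // (p.1.2 ≠ M ∧ descendants p.1.1 M = (S : Set α)ᶜ) ∧ P p} := by
  classical
  have := Fintype.ofFinite {S : Set α // M ∉ S}
  have h1 : Nat.card {p : RootedMap α // P p} =
      Nat.card {p : RootedMap α // p.1.2 = M ∧ P p} +
      Nat.card {p : RootedMap α // p.1.2 ≠ M ∧ P p} := by
    have h := Set.ncard_inter_add_ncard_sdiff_eq_ncard {p : RootedMap α | P p} {p | p.1.2 = M}
    simp only [← Nat.card_coe_set_eq] at h
    refine h.symm.trans ?_
    congr 1
    · exact Nat.card_congr (Equiv.subtypeEquivRight fun p => and_comm)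
    · exact Nat.card_congr (Equiv.subtypeEquivRight fun p => and_comm)
  rw [h1, finsum_eq_sum_of_fintype, ← Nat.card_sigma]
  congr 1
  refine Nat.card_congr
    { toFun := fun p => ⟨⟨(descendants p.1.1.1 M)ᶜ, fun h => h ⟨0, rfl⟩⟩,
        ⟨p.1, ⟨p.2.1, (compl_compl _).symm⟩, p.2.2⟩⟩
      invFun := fun q => ⟨q.2.1, q.2.2.1.1, q.2.2.2⟩
      left_inv := fun _ => rfl
      right_inv := ?_ }
  rintro ⟨⟨S, hS⟩, ⟨p, ⟨hp, hd⟩, hP⟩⟩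
  obtain rfl : S = (descendants p.1.1 M)ᶜ := by rw [hd, compl_compl]
  rfl

lemma card_rootedMap_eq (M : α) :
    Nat.card (RootedMap α) = rootedAtCount M +
      ∑ᶠ S : {S : Set α // M ∉ S}, Nat.card (RootedMap (S : Set α)) * (S : Set α).ncard *
        rootedAtCount (⟨M, S.2⟩ : ↥(S : Set α)ᶜ) := by
  have h := card_eq_sum_descendants M fun _ => True
  rw [Nat.card_congr (Equiv.subtypeUnivEquiv fun _ => trivial)] at h
  rw [h]
  congr 1
  · exact card_root_eq M fun _ _ => trivial
  · refine finsum_congr fun S => ?_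
    rw [Nat.card_congr ((Equiv.subtypeEquivRight fun p => iff_of_eq (and_true _)).trans
      (glueEquiv S.2).symm), Nat.card_prod, Nat.card_prod, ← mul_assoc, Nat.card_coe_set_eq]
    rfl

lemma recordCount_zero [PartialOrder α] (M : α) (hmax : ∀ x, x ≤ M) : recordCount α 0 = 0 := by
  have : IsEmpty {p : RootedMap α // (parentMapRecords p.1.1).ncard = 0} := by
    refine ⟨fun p => ?_⟩
    have h := (Set.ncard_eq_zero (Set.toFinite _)).1 p.2
    exact (h ▸ (fun i => hmax _ : M ∈ parentMapRecords p.1.1.1) : M ∈ (∅ : Set α))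
  exact Nat.card_of_isEmpty

lemma recordCount_succ [PartialOrder α] (M : α) (hmax : ∀ x, x ≤ M) (k : ℕ) :
    recordCount α (k + 1) = (if k = 0 then rootedAtCount M else 0) +
      ∑ᶠ S : {S : Set α // M ∉ S}, recordCount (S : Set α) k * (S : Set α).ncard *
        rootedAtCount (⟨M, S.2⟩ : ↥(S : Set α)ᶜ) := by
  rw [recordCount, card_eq_sum_descendants M]
  congr 1
  · have hrec (f : α → α) (hf : IsParentMap M f) : (parentMapRecords f).ncard = 1 := by
      rw [Set.ncard_eq_one]
      refine ⟨M, Set.ext fun x => ⟨fun hx => ?_, ?_⟩⟩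
      · obtain ⟨i, hi⟩ := hf.2 x
        exact le_antisymm (hmax x) (hi ▸ hx i)
      · rintro rfl i
        exact hmax _
    split_ifs with hk
    · subst hk
      exact card_root_eq M fun f hf => hrec f hf
    · have : IsEmpty {p : RootedMap α //
          p.1.2 = M ∧ (parentMapRecords p.1.1).ncard = k + 1} := by
        refine ⟨?_⟩
        rintro ⟨⟨⟨f, r⟩, hf⟩, hr, hk'⟩
        obtain rfl : r = M := hr
        have := hrec f hf
        simp only at hk'
        omega
      exact Nat.card_of_isEmpty
  · refine finsum_congr fun S => ?_
    have e1 : {q : GlueData S.2 // (parentMapRecords q.1.1.1).ncard = k} ≃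
        {p : RootedMap α // (p.1.2 ≠ M ∧ descendants p.1.1 M = (S : Set α)ᶜ) ∧
          (parentMapRecords p.1.1).ncard = k + 1} :=
      ((glueEquiv S.2).subtypeEquiv
        (q := fun p => (parentMapRecords p.1.1.1).ncard = k + 1) fun q => by
          rw [← Nat.add_right_cancel_iff (n := 1),
            ← ncard_parentMapRecords_glueMap (u := q.2.1) hmax S.2 q.2.2.2]
          rfl).trans
        (Equiv.subtypeSubtypeEquivSubtypeInter _
          fun p : RootedMap α => (parentMapRecords p.1.1).ncard = k + 1)
    have e2 : {q : GlueData S.2 // (parentMapRecords q.1.1.1).ncard = k} ≃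
        {p : RootedMap (S : Set α) // (parentMapRecords p.1.1).ncard = k} × ↥(S : Set α) ×
          {h : ↥(S : Set α)ᶜ → ↥(S : Set α)ᶜ // IsParentMap ⟨M, S.2⟩ h} :=
      { toFun := fun q => ⟨⟨q.1.1, q.2⟩, q.1.2⟩
        invFun := fun q => ⟨⟨q.1.1, q.2⟩, q.1.2⟩
        left_inv := fun _ => rfl
        right_inv := fun _ => rfl }
    rw [Nat.card_congr (e1.symm.trans e2), Nat.card_prod, Nat.card_prod, ← mul_assoc,
      Nat.card_coe_set_eq]
    rfl

end Recursion

/-! ### Abel polynomials and Abel's binomial identity -/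

/-- The Abel polynomials `x (x + m) ^ (m - 1)`. -/
def abelPoly : ℕ → ℝ → ℝ
  | 0, _ => 1
  | m + 1, x => x * (x + (m + 1)) ^ m

lemma hasDerivAt_abelPoly_succ (m : ℕ) (x : ℝ) :
    HasDerivAt (abelPoly (m + 1)) ((m + 1) * abelPoly m (x + 1)) x := by
  have h := (hasDerivAt_id x).mul (((hasDerivAt_id x).add_const ((m : ℝ) + 1)).pow m)
  refine h.congr_deriv ?_
  cases m with
  | zero => simp [abelPoly]
  | succ m =>
    simp only [abelPoly, id, Pi.pow_apply, Nat.add_sub_cancel]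
    push_cast
    ring

/-- By induction both sides have the same derivative in `x`, and they agree at `x = 0`, where all
Abel polynomials of positive index vanish. -/
lemma sum_choose_abelPoly_mul (N : ℕ) (x y : ℝ) :
    ∑ i ∈ Finset.range (N + 1), (N.choose i : ℝ) * abelPoly i x * abelPoly (N - i) y =
      abelPoly N (x + y) := by
  induction N generalizing x with
  | zero => simp [abelPoly]
  | succ N ih =>
    have hL (x : ℝ) : HasDerivAt (fun x => ∑ i ∈ Finset.range (N + 1 + 1),
        ((N + 1).choose i : ℝ) * abelPoly i x * abelPoly (N + 1 - i) y)
        ((N + 1) * abelPoly N (x + 1 + y)) x := by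
      simp only [Finset.sum_range_succ' _ (N + 1)]
      have h0 : HasDerivAt (fun x => ((N + 1).choose 0 : ℝ) * abelPoly 0 x *
          abelPoly (N + 1 - 0) y) 0 x := by
        simpa only [abelPoly] using hasDerivAt_const x _
      have h := (HasDerivAt.fun_sum (u := Finset.range (N + 1)) fun i _ =>
        ((hasDerivAt_abelPoly_succ i x).const_mul ((N + 1).choose (i + 1) : ℝ)).mul_const
          (abelPoly (N + 1 - (i + 1)) y)).add h0
      refine h.congr_deriv ?_
      rw [← ih (x + 1), Finset.mul_sum, add_zero]
      refine Finset.sum_congr rfl fun i _ => ?_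
      have hc : ((N : ℝ) + 1) * N.choose i = (N + 1).choose (i + 1) * (i + 1) := by
        exact_mod_cast Nat.add_one_mul_choose_eq N i
      rw [Nat.add_sub_add_right]
      linear_combination -(abelPoly i (x + 1) * abelPoly (N - i) y) * hc
    have hR (x : ℝ) : HasDerivAt (fun x => abelPoly (N + 1) (x + y))
        ((N + 1) * abelPoly N (x + 1 + y)) x := by
      have h := (hasDerivAt_abelPoly_succ N (x + y)).comp_add_const x y
      rwa [add_right_comm] at h
    refine congrFun (eq_of_fderiv_eq (𝕜 := ℝ) (fun x => (hL x).differentiableAt)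
      (fun x => (hR x).differentiableAt)
      (fun x => (hL x).hasFDerivAt.fderiv.trans (hR x).hasFDerivAt.fderiv.symm) 0 ?_) x
    simp [Finset.sum_range_succ', abelPoly]

lemma add_mul_abelPoly (m : ℕ) (x : ℝ) : (x + m) * abelPoly m x = x * (x + m) ^ m := by
  cases m with
  | zero => simp [abelPoly]
  | succ m =>
    simp only [abelPoly]
    push_cast
    ring

/-- Symmetrising under `i ↦ N - i` replaces the weight `i + 1` by the constant `N + 2` in twice the
sum, and Abel's identity at `x = y = 1` applies. -/
lemma sum_choose_mul_abelPoly_one (N : ℕ) :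
    ∑ i ∈ Finset.range (N + 1), (N.choose i : ℝ) * ((i + 1) * abelPoly i 1) *
      abelPoly (N - i) 1 = abelPoly (N + 1) 1 := by
  set S := ∑ i ∈ Finset.range (N + 1), (N.choose i : ℝ) * ((i + 1) * abelPoly i 1) *
      abelPoly (N - i) 1 with hS
  have h1 : S = ∑ i ∈ Finset.range (N + 1), (N.choose i : ℝ) * abelPoly i 1 *
      (((N - i : ℕ) + 1) * abelPoly (N - i) 1) := by
    rw [hS, ← Finset.sum_range_reflect]
    refine Finset.sum_congr rfl fun i hi => ?_
    have hi' : i ≤ N := Nat.lt_succ_iff.1 (Finset.mem_range.1 hi)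
    rw [Nat.add_sub_cancel, Nat.choose_symm hi', Nat.sub_sub_self hi']
    ring
  have h2 : S + S = (2 + N) * abelPoly N (1 + 1) := by
    nth_rewrite 2 [h1]
    rw [hS, ← sum_choose_abelPoly_mul, Finset.mul_sum, ← Finset.sum_add_distrib]
    refine Finset.sum_congr rfl fun i hi => ?_
    rw [Nat.cast_sub (Nat.lt_succ_iff.1 (Finset.mem_range.1 hi))]
    ring
  rw [one_add_one_eq_two, add_mul_abelPoly] at h2
  simp only [abelPoly]
  rw [show (1 : ℝ) + (N + 1) = 2 + N by ring]
  linarith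

/-! ### Numerical recursions and their solution -/

lemma finsum_set_notMem {α : Type*} [Finite α] (M : α) (F : ℕ → ℕ) :
    ∑ᶠ S : {S : Set α // M ∉ S}, F (S : Set α).ncard =
      ∑ j ∈ Finset.range (Nat.card α), (Nat.card α - 1).choose j * F j := by
  classical
  have := Fintype.ofFinite α
  let e : {s // s ∈ (Finset.univ.erase M).powerset} ≃ {S : Set α // M ∉ S} :=
    Fintype.finsetEquivSet.subtypeEquiv fun s => by
      simp [Finset.subset_erase]
  have key (s : {s // s ∈ (Finset.univ.erase M).powerset}) :
      (e s : Set α).ncard = (s : Finset α).card := Set.ncard_coe_finset _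
  rw [← finsum_comp_equiv e, finsum_eq_sum_of_fintype]
  simp only [key]
  rw [Finset.sum_coe_sort _ fun s : Finset α => F s.card, Finset.sum_powerset_apply_card,
    Finset.card_erase_of_mem (Finset.mem_univ M), Finset.card_univ, Nat.card_eq_fintype_card,
    Nat.sub_add_cancel (Fintype.card_pos_iff.2 ⟨M⟩)]
  simp

/-- The number of trees on `n + 1` labelled nodes. -/
noncomputable def treeCount (n : ℕ) : ℕ := rootedAtCount (0 : Fin (n + 1))

section
variable {n : ℕ}

lemma rootedAtCount_compl {S : Set (Fin (n + 1))} (M : ↥Sᶜ) :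
    rootedAtCount M = treeCount (n - S.ncard) := by
  refine rootedAtCount_eq_of_card_eq ?_ _ _
  have h1 := Set.ncard_add_ncard_compl S
  have h2 : 0 < Sᶜ.ncard := (Set.ncard_pos).2 ⟨_, M.2⟩
  simp only [Nat.card_coe_set_eq, Nat.card_fin] at *
  omega

lemma recordCount_set (S : Set (Fin n)) (k : ℕ) :
    recordCount S k = recordCount (Fin S.ncard) k := by
  classical
  have := Fintype.ofFinite S
  exact recordCount_congr (Fintype.orderIsoFinOfCardEq S
    (by rw [← Nat.card_eq_fintype_card, Nat.card_coe_set_eq])).symm k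

lemma card_rootedMap_set (S : Set (Fin n)) :
    Nat.card (RootedMap S) = Nat.card (RootedMap (Fin S.ncard)) :=
  Nat.card_congr (RootedMap.congr (Finite.equivFinOfCardEq (Nat.card_coe_set_eq S)))

end

lemma treeCount_recursion (n : ℕ) :
    (n + 1) * treeCount n = treeCount n + ∑ j ∈ Finset.range (n + 1),
      n.choose j * (Nat.card (RootedMap (Fin j)) * j * treeCount (n - j)) := by
  have h := card_rootedMap_eq (Fin.last n)
  simp only [card_rootedMap_set, rootedAtCount_compl] at h
  rw [finsum_set_notMem _ fun j => Nat.card (RootedMap (Fin j)) * j * treeCount (n - j),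
    card_rootedMap 0, rootedAtCount_eq_of_card_eq rfl (Fin.last n) 0] at h
  simpa [treeCount] using h

lemma recordCount_recursion (n k : ℕ) :
    recordCount (Fin (n + 1)) (k + 1) = (if k = 0 then treeCount n else 0) +
      ∑ j ∈ Finset.range (n + 1),
        n.choose j * (recordCount (Fin j) k * j * treeCount (n - j)) := by
  have h := recordCount_succ (Fin.last n) Fin.le_last k
  simp only [recordCount_set, rootedAtCount_compl] at h
  rw [finsum_set_notMem _ fun j => recordCount (Fin j) k * j * treeCount (n - j),
    rootedAtCount_eq_of_card_eq rfl (Fin.last n) 0] at h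
  simpa [treeCount] using h

/-- Cayley's formula. -/
lemma treeCount_eq (n : ℕ) : (treeCount n : ℝ) = abelPoly n 1 := by
  induction n using Nat.strong_induction_on with
  | _ n ih =>
  have h := treeCount_recursion n
  rw [Finset.sum_range_succ'] at h
  have hZ (j : ℕ) : Nat.card (RootedMap (Fin (j + 1))) = (j + 1) * treeCount j := by
    rw [card_rootedMap 0, Nat.card_fin, treeCount]
  cases n with
  | zero =>
    have : treeCount 0 = 1 := by
      rw [treeCount, rootedAtCount, Nat.card_eq_one_iff_unique]
      have : Subsingleton (Fin (0 + 1)) := Fin.subsingleton_one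
      exact ⟨inferInstance, ⟨id, rfl, fun x => ⟨0, Subsingleton.elim _ _⟩⟩⟩
    simp [abelPoly, this]
  | succ N =>
    simp only [hZ, mul_zero, zero_mul, add_zero] at h
    -- One copy of the unknown cancels, leaving the coefficient `N + 1`. This would be zero for a
    -- single node, hence the separate base case.
    have h' : ((N : ℝ) + 1) * treeCount (N + 1) = (N + 1) * abelPoly (N + 1) 1 := by
      have h2 : (((N + 1 + 1) * treeCount (N + 1) : ℕ) : ℝ) = _ := congrArg Nat.cast h
      push_cast at h2
      rw [← sum_choose_mul_abelPoly_one, Finset.mul_sum]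
      rw [show ((N : ℝ) + 1) * treeCount (N + 1) =
        (N + 1 + 1) * treeCount (N + 1) - treeCount (N + 1) by ring, h2, add_sub_cancel_left]
      refine Finset.sum_congr rfl fun j hj => ?_
      have hj' := Finset.mem_range.1 hj
      rw [ih j hj', ih (N - j) (by omega)]
      have hc : ((N : ℝ) + 1) * N.choose j = (N + 1).choose (j + 1) * (j + 1) := by
        exact_mod_cast Nat.add_one_mul_choose_eq N j
      linear_combination -((j + 1) * abelPoly j 1 * abelPoly (N - j) 1) * hc
    exact mul_left_cancel₀ (by positivity) h'

lemma choose_mul_descFactorial (n : ℕ) {j k : ℕ} (hkj : k ≤ j) :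
    n.choose j * j.descFactorial k = n.descFactorial k * (n - k).choose (j - k) := by
  rw [Nat.descFactorial_eq_factorial_mul_choose, Nat.descFactorial_eq_factorial_mul_choose]
  rw [mul_left_comm, Nat.choose_mul hkj, mul_assoc]

/-- The factor `n` matches the factor `j` in the recursion, so the induction hypothesis applies to
`j * recordCount (Fin j) _` directly. `choose_mul_descFactorial` then pulls the falling factorial
out of the sum, and Abel's identity with `x = k + 1`, `y = 1` remains. -/
lemma recordCount_eq (n k : ℕ) : (n : ℝ) * recordCount (Fin n) (k + 1) =
    n.descFactorial (k + 1) * abelPoly (n - (k + 1)) (k + 1) := by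
  induction k generalizing n with
  | zero =>
    cases n with
    | zero => simp
    | succ n =>
      have h0 : recordCount (Fin (n + 1)) 1 = treeCount n := by
        rw [recordCount_recursion, if_pos rfl, Finset.sum_eq_zero, add_zero]
        intro j _
        cases j with
        | zero => simp
        | succ j => simp [recordCount_zero (Fin.last j) Fin.le_last]
      simp [h0, treeCount_eq]
  | succ k ih =>
    cases n with
    | zero => simp
    | succ n =>
      have h := congrArg (Nat.cast (R := ℝ)) (recordCount_recursion n (k + 1))
      push_cast at h
      rw [zero_add] at h
      rw [h, Nat.succ_descFactorial_succ, Nat.add_sub_add_right]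
      push_cast
      rw [mul_assoc]
      congr 1
      rcases lt_or_ge n (k + 1) with hn | hn
      · rw [Nat.descFactorial_of_lt hn, Nat.cast_zero, zero_mul]
        refine Finset.sum_eq_zero fun j hj => ?_
        have hj' := Finset.mem_range.1 hj
        rw [mul_comm (recordCount _ _ : ℝ), ih, Nat.descFactorial_of_lt (by omega)]
        simp
      · obtain ⟨m, rfl⟩ := Nat.exists_eq_add_of_le hn
        -- The terms with `j < k + 1` vanish with their falling factorials; the rest is reindexed
        -- from `k + 1`.
        rw [add_assoc, Finset.sum_range_add, Finset.sum_eq_zero, zero_add,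
          Nat.add_sub_cancel_left, ← sum_choose_abelPoly_mul, Finset.mul_sum]
        · refine Finset.sum_congr rfl fun j hj => ?_
          have hj' := Finset.mem_range.1 hj
          have hc := congrArg (Nat.cast (R := ℝ)) (choose_mul_descFactorial
            (k + 1 + m) (Nat.le_add_right (k + 1) j))
          rw [Nat.add_sub_cancel_left, Nat.add_sub_cancel_left] at hc
          push_cast at hc
          rw [mul_comm (recordCount _ _ : ℝ), ih, Nat.add_sub_add_left,
            Nat.add_sub_cancel_left, treeCount_eq]
          linear_combination (abelPoly j (k + 1) * abelPoly (m - j) 1) * hc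
        · intro j hj
          rw [mul_comm (recordCount _ _ : ℝ), ih,
            Nat.descFactorial_of_lt (Finset.mem_range.1 hj)]
          simp

/-! ### Asymptotics -/

theorem mainTheorem12 (k : ℕ) :
    (fun n : ℕ => (treeRecordNumber n k : ℝ)) ~[atTop]
      (fun n : ℕ => (k : ℝ) * (n : ℝ) ^ ((n : ℤ) - 2)) := by
  simp only [treeRecordNumber_eq_recordCount]
  cases k with
  | zero =>
    refine EventuallyEq.isEquivalent ?_
    filter_upwards [eventually_gt_atTop 0] with n hn
    obtain ⟨n, rfl⟩ := Nat.exists_eq_add_of_lt hn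
    simp [recordCount_zero (Fin.last (0 + n)) Fin.le_last]
  | succ k =>
    have h := (isEquivalent_descFactorial (k + 1)).mul (IsEquivalent.refl
      (u := fun n : ℕ => ((k + 1 : ℕ) : ℝ) * (n : ℝ) ^ ((n : ℤ) - (k + 1) - 2)) (l := atTop))
    refine (h.congr_left ?_).congr_right ?_
    -- Beyond `k + 1` the Abel polynomial has positive index, so its power form applies. Integer
    -- exponents are needed because `n - (k + 1) - 2` is `-1` at `n = k + 2`.
    · filter_upwards [eventually_gt_atTop (k + 1)] with n hn
      have hn0 : (n : ℝ) ≠ 0 := Nat.cast_ne_zero.2 (by omega)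
      obtain ⟨m, rfl⟩ := Nat.exists_eq_add_of_lt hn
      refine mul_left_cancel₀ hn0 ?_
      rw [recordCount_eq, show k + 1 + m + 1 - (k + 1) = m + 1 by omega, abelPoly,
        show ((k : ℝ) + 1 + (m + 1)) = (k + 1 + m + 1 : ℕ) by push_cast; ring,
        ← zpow_natCast _ m,
        show (m : ℤ) = 1 + (((k + 1 + m + 1 : ℕ) : ℤ) - (k + 1) - 2) by push_cast; ring,
        zpow_one_add₀ hn0, Pi.mul_apply]
      push_cast
      ring
    · filter_upwards [eventually_gt_atTop 0] with n hn
      have hn0 : (n : ℝ) ≠ 0 := Nat.cast_ne_zero.2 hn.ne'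
      rw [Pi.mul_apply, show (n : ℤ) - 2 = (k + 1 : ℕ) + ((n : ℤ) - (k + 1) - 2) by
        push_cast; ring, zpow_add₀ hn0, zpow_natCast]
      ring
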